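/- Let $1<p_0<q<\infty$, $p_1\in(1,\infty)$ and $q_0\in[1,\infty]$, and put $r=\frac{p_0q}{p_1(q-p_0)}$. For a measurable function $f$ on $(0,\infty)$ (with Lebesgue measure) let $f^*(t)=\inf\{\lambda\ge 0:|\{|f|>\lambda\}|\le t\}$ be its non-increasing rearrangement, let $$\|f\|_{r,s}=\Bigl(\int_0^\infty \bigl(t^{\frac1r-\frac1s}f^*(t)\bigr)^{s}\,dt\Bigr)^{1/s}\quad(s<\infty),\qquad \|f\|_{r,\infty}=\sup_{t>0}t^{\frac1r}f^*(t)$$ be the Lorentz functional ($1/\infty=0$), and let $L^{r,s}=L^{r,s}(0,\infty)$ be the set of all measurable $f:(0,\infty)\to[-\infty,\infty]$ with $\|f\|_{r,s}<\infty$. Call $(r,s)$ normable if $r=s=1$, or $1<r<\infty$ and $1\le s\le\infty$, or $r=s=\infty$ (these are the pairs for which $L^{r,s}$ is equivalent to a rearrangement-invariant Banach function space). For $f\ge0$ measurable on $(0,\infty)$ and $t>0$ let $$R_{q_0}f(t)=t^{-\frac1{p_1}}\Bigl(\int_0^{t^r}s^{\frac{q_0}{p_0}-1}f^*(s)^{q_0}\,ds\Bigr)^{\frac1{q_0}},$$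 where the second factor means $\sup_{0<s\le t^r}s^{1/p_0}f^*(s)$ if $q_0=\infty$. (a) Let $(r_1,s_1)$ and $(r_2,s_2)$ be normable. Then $R_{q_0}$ is bounded from $L^{r_1,s_1}$ to $L^{r_2,s_2}$, that is, there is a constant $C<\infty$ with $\|R_{q_0}f\|_{r_2,s_2}\le C\|f\|_{r_1,s_1}$ for all $0\le f\in L^{r_1,s_1}$, if and only if $$\frac1q+\frac1{r\,r_2}=\frac1{r_1}$$ and one of the following conditions holds: (i) $r_1=p_0$, $s_1\le q_0$ and $s_2=\infty$; (ii) $r_1\in(p_0,q]$ and $1\le s_1\le s_2\le\infty$. (b) Let $1\le p<\rho\le\infty$ and let $(\rho,s)$ be normable. Let $(L^{\rho,s})^{\langle p,q_0\rangle}$ be the set of all measurable $f:(0,\infty)\to[-\infty,\infty]$ with finite $$\|f\|_{(L^{\rho,s})^{\langle p,q_0\rangle}}=\Bigl\|\,t^{-\frac1p}\Bigl(\int_0^t \tau^{\frac{q_0}{p}-1}f^*(\tau)^{q_0}\,d\tau\Bigr)^{\frac1{q_0}}\Bigr\|_{\rho,s}$$ (with $\sup_{0<\tau\le t}\tau^{1/p}f^*(\tau)$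 in place of the second factor if $q_0=\infty$). Then $(L^{\rho,s})^{\langle p,q_0\rangle}=L^{\rho,s}$, with equivalent functionals. -/

import Mathlib

open MeasureTheory Set
open scoped ENNReal NNReal

noncomputable section

namespace LorentzCalderon

/-- Lebesgue measure on the half-line `(0, ∞)`. Functions on `(0, ∞)` are represented by functions
on `ℝ`, whose values outside `(0, ∞)` play no role. -/
def halfLine : Measure ℝ := volume.restrict (Ioi (0 : ℝ))

/-- The non-increasing rearrangement `f^*(t) = inf {l ≥ 0 : |{f > l}| ≤ t}` of a non-negative
function on `(0, ∞)`. -/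
def rearrangement (f : ℝ → ℝ≥0∞) (t : ℝ) : ℝ≥0∞ :=
  sInf {l : ℝ≥0∞ | halfLine {x | l < f x} ≤ ENNReal.ofReal t}

/-- The Lorentz functional `‖t^{1/r - 1/s} f^*(t)‖_{L^s(0,∞)}` (with `1/∞ = 0`). -/
def lorentzNorm (r s : ℝ≥0∞) (f : ℝ → ℝ≥0∞) : ℝ≥0∞ :=
  if s = ∞ then
    ⨆ t ∈ Ioi (0 : ℝ), ENNReal.ofReal (t ^ r⁻¹.toReal) * rearrangement f t
  else
    (∫⁻ t in Ioi (0 : ℝ),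
      (ENNReal.ofReal (t ^ (r⁻¹.toReal - s⁻¹.toReal)) * rearrangement f t) ^ s.toReal)
        ^ (1 / s.toReal)

/-- The parameters for which `L^{r,s}` is normable, that is, equivalent to a
rearrangement-invariant Banach function space. -/
def NormableParams (r s : ℝ≥0∞) : Prop :=
  (r = 1 ∧ s = 1) ∨ (1 < r ∧ r < ∞ ∧ 1 ≤ s) ∨ (r = ∞ ∧ s = ∞)

/-- The quantity `(∫_0^t s^{q₀/p - 1} f^*(s)^{q₀} ds)^{1/q₀}`, read as
`sup_{0 < s ≤ t} s^{1/p} f^*(s)` when `q₀ = ∞`. -/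
def localLorentz (p : ℝ) (q₀ : ℝ≥0∞) (f : ℝ → ℝ≥0∞) (t : ℝ) : ℝ≥0∞ :=
  if q₀ = ∞ then
    ⨆ s ∈ Ioc (0 : ℝ) t, ENNReal.ofReal (s ^ (1 / p)) * rearrangement f s
  else
    (∫⁻ s in Ioc (0 : ℝ) t,
      ENNReal.ofReal (s ^ (q₀.toReal / p - 1)) * rearrangement f s ^ q₀.toReal)
        ^ (1 / q₀.toReal)

/-- The exponent `r = p₀ q / (p₁ (q - p₀))`. -/
def rExp (p₀ p₁ q : ℝ) : ℝ := p₀ * q / (p₁ * (q - p₀))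

/-- The operator `R_{q₀} f(t) = t^{-1/p₁} (∫_0^{t^r} s^{q₀/p₀ - 1} f^*(s)^{q₀} ds)^{1/q₀}`. -/
def opR (p₀ p₁ q : ℝ) (q₀ : ℝ≥0∞) (f : ℝ → ℝ≥0∞) (t : ℝ) : ℝ≥0∞ :=
  ENNReal.ofReal (t ^ (-(1 / p₁))) * localLorentz p₀ q₀ f (t ^ rExp p₀ p₁ q)

/-- The functional of `X^{⟨p,q₀⟩}`, where `ρ` is the functional of `X`. -/
def angleNorm (ρ : (ℝ → ℝ≥0∞) → ℝ≥0∞) (p : ℝ) (q₀ : ℝ≥0∞) (f : ℝ → ℝ≥0∞) : ℝ≥0∞ :=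
  ρ fun t => ENNReal.ofReal (t ^ (-(1 / p))) * localLorentz p q₀ f t

/-- The space of all measurable `f : (0, ∞) → [-∞, ∞]` with `ρ(|f|) < ∞`. -/
def space (ρ : (ℝ → ℝ≥0∞) → ℝ≥0∞) : Set (ℝ → EReal) :=
  {f | AEMeasurable f halfLine ∧ ρ (fun t => (f t).abs) < ∞}

/-- Boundedness of an operator on non-negative measurable functions on `(0, ∞)`, from the space
given by `ρ₁` to the space given by `ρ₂`. -/
def IsBoundedOp (T : (ℝ → ℝ≥0∞) → ℝ → ℝ≥0∞) (ρ₁ ρ₂ : (ℝ → ℝ≥0∞) → ℝ≥0∞) : Prop :=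
  ∃ C : ℝ≥0, ∀ f : ℝ → ℝ≥0∞, AEMeasurable f halfLine → ρ₁ f < ∞ → ρ₂ (T f) ≤ C * ρ₁ f

/-- Equivalence of two functionals on the non-negative measurable functions on `(0, ∞)`. -/
def NormEquiv (ρ₁ ρ₂ : (ℝ → ℝ≥0∞) → ℝ≥0∞) : Prop :=
  ∃ C : ℝ≥0, 0 < C ∧ ∀ f : ℝ → ℝ≥0∞, AEMeasurable f halfLine →
    ρ₁ f ≤ C * ρ₂ f ∧ ρ₂ f ≤ C * ρ₁ f

end LorentzCalderon

end

open LorentzCalderon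

/-!
In the coordinate `x = log t` the Lorentz functional `‖f‖_{r,s}` is the `L^s(ℝ)` norm of
`e^{x/r} f^*(e^x)` and dilations become translations. The function `T = R_{q₀} f` is
quasi-monotone: `t^{1/p₁} T(t)` is non-decreasing, so `T` loses at most a constant factor between
`t` and `e t`. Hence, up to a constant, `T^*(t)` dominates `T(t)` and is dominated by
`sup_k T(e^{k+1} t)`, and the norms of `T` and `T^*` are comparable.

For sufficiency, the defining integral is dominated by a geometric series of translates of
`e^{x/r₁} f^*(e^x)` when `r₁ > p₀`, and Minkowski's inequality applies; for `r₁ = p₀` the target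
norm is a supremum and there is nothing to sum. For necessity, the indicators of `(0, e^ξ)` force
the relation between `r₁` and `r₂` and the condition that `1/r₂ < 1/p₁`, or `r₂ = p₁` and `s₂ = ∞`.
The target norm of `R_{q₀} f` then dominates a Lorentz norm of `f` with first exponent `r₁` and
second exponent `s₂` or `q₀`, so boundedness yields an embedding between Lorentz spaces with the
same first exponent `r₁`, and truncations of `min(1, t^{-1/r₁})` force the second exponents to be
ordered. The functional of part (b) is the case `p₁ = p₀` with `t` in place of `t^r`.
-/

noncomputable section

open Filter Topology

namespace LorentzCalderon

section LpNorms

variable {X : Type*} [MeasurableSpace X] {μ : Measure X}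

theorem eLpNorm_tsum_le {s : ℝ≥0∞} (hs : 1 ≤ s) {g : ℕ → X → ℝ≥0∞}
    (hg : ∀ k, AEMeasurable (g k) μ) :
    eLpNorm (fun x => ∑' k, g k x) s μ ≤ ∑' k, eLpNorm (g k) s μ := by
  obtain rfl | hs' := eq_or_ne s ∞
  · refine essSup_le_of_ae_le _ ?_
    filter_upwards [ae_all_iff.2 fun k => enorm_ae_le_eLpNormEssSup (g k) μ] with x hx
    exact ENNReal.tsum_le_tsum fun k => by simpa using hx k
  have hs0 : s ≠ 0 := (zero_lt_one.trans_le hs).ne'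
  have hpos := ENNReal.toReal_pos hs0 hs'
  let S : ℕ → X → ℝ≥0∞ := fun n x => ∑ k ∈ Finset.range n, g k x
  have S_monotone : Monotone S := fun m n h x => Finset.sum_le_sum_of_subset (Finset.range_mono h)
  have S_measurable : ∀ n, AEMeasurable (fun x => S n x ^ s.toReal) μ := fun n =>
    (Finset.aemeasurable_fun_sum _ fun k _ => hg k).pow_const _
  have partial_le : ∀ n, (∫⁻ x, S n x ^ s.toReal ∂μ) ^ s.toReal⁻¹ ≤ ∑' k, eLpNorm (g k) s μ := by
    intro n
    calc (∫⁻ x, S n x ^ s.toReal ∂μ) ^ s.toReal⁻¹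
        = eLpNorm (∑ k ∈ Finset.range n, g k) s μ := by
          simp [eLpNorm_eq_lintegral_rpow_enorm_toReal hs0 hs', S]
      _ ≤ ∑ k ∈ Finset.range n, eLpNorm (g k) s μ :=
          eLpNorm_sum_le (fun k _ => (hg k).aestronglyMeasurable) hs
      _ ≤ _ := ENNReal.sum_le_tsum _
  have tsum_rpow : ∀ x, (∑' k, g k x) ^ s.toReal = ⨆ n, S n x ^ s.toReal := fun x => by
    rw [ENNReal.tsum_eq_iSup_nat, (ENNReal.monotone_rpow_of_nonneg hpos.le).map_iSup_of_continuousAt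
      (ENNReal.continuous_rpow_const.continuousAt) (by simp [hpos])]
  rw [eLpNorm_eq_lintegral_rpow_enorm_toReal hs0 hs']
  simp only [enorm_eq_self, tsum_rpow]
  rw [lintegral_iSup' S_measurable
    (ae_of_all _ fun x m n h => ENNReal.rpow_le_rpow (S_monotone h x) hpos.le),
    one_div, ENNReal.rpow_inv_le_iff hpos, iSup_le_iff]
  exact fun n => (ENNReal.rpow_inv_le_iff hpos).1 (partial_le n)

theorem eLpNorm_le_const_mul_of_ae_le {s₁ s₂ K : ℝ≥0∞} (hs₁ : s₁ ≠ 0) (hs : s₁ ≤ s₂) (hK : 1 ≤ K)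
    {g : X → ℝ≥0∞} (h : ∀ᵐ x ∂μ, g x ≤ K * eLpNorm g s₁ μ) :
    eLpNorm g s₂ μ ≤ K * eLpNorm g s₁ μ := by
  obtain rfl | hs₂ := eq_or_ne s₂ ∞
  · exact essSup_le_of_ae_le _ (h.mono fun x hx => by simpa using hx)
  set M := K * eLpNorm g s₁ μ
  obtain hM' | hM' := eq_or_ne M ∞
  · simp [hM']
  have hs₁' := ne_top_of_le_ne_top hs₂ hs
  have hs₂0 := ne_bot_of_le_ne_bot hs₁ hs
  have hpos₁ := ENNReal.toReal_pos hs₁ hs₁'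
  have hpos₂ := ENNReal.toReal_pos hs₂0 hs₂
  have hle : 0 ≤ s₂.toReal - s₁.toReal := sub_nonneg.2 (ENNReal.toReal_mono hs₂ hs)
  have norm_rpow : ∫⁻ x, g x ^ s₁.toReal ∂μ = eLpNorm g s₁ μ ^ s₁.toReal := by
    simp [eLpNorm_eq_lintegral_rpow_enorm_toReal hs₁ hs₁', ← ENNReal.rpow_mul, hpos₁.ne']
  have rpow_split : ∀ x : ℝ≥0∞, x ^ s₂.toReal = x ^ (s₂.toReal - s₁.toReal) * x ^ s₁.toReal :=
    fun x => by rw [← ENNReal.rpow_add_of_nonneg _ _ hle hpos₁.le, sub_add_cancel]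
  rw [eLpNorm_eq_lintegral_rpow_enorm_toReal hs₂0 hs₂, one_div, ENNReal.rpow_inv_le_iff hpos₂]
  simp only [enorm_eq_self]
  calc ∫⁻ x, g x ^ s₂.toReal ∂μ
      ≤ ∫⁻ x, M ^ (s₂.toReal - s₁.toReal) * g x ^ s₁.toReal ∂μ := by
        refine lintegral_mono_ae (h.mono fun x hx => ?_)
        rw [rpow_split]
        gcongr
    _ = M ^ (s₂.toReal - s₁.toReal) * eLpNorm g s₁ μ ^ s₁.toReal := by
        rw [lintegral_const_mul' _ _ (ENNReal.rpow_ne_top_of_nonneg hle hM'), norm_rpow]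
    _ ≤ M ^ s₂.toReal := by
        rw [rpow_split M]
        gcongr
        exact le_mul_of_one_le_left' hK

theorem eLpNorm_tsum_translate_le {G : Type*} [AddGroup G] [MeasurableSpace G] [MeasurableAdd G]
    {μ : Measure G} [μ.IsAddRightInvariant] {s : ℝ≥0∞} (hs : 1 ≤ s) (w : ℕ → ℝ≥0∞) (d : ℕ → G)
    {h : G → ℝ≥0∞} (hh : Measurable h) :
    eLpNorm (fun x => ∑' k, w k * h (x + d k)) s μ ≤ (∑' k, w k) * eLpNorm h s μ := by
  have hd : ∀ k, Measurable fun x => h (x + d k) := fun k => hh.comp (measurable_add_const _)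
  calc eLpNorm (fun x => ∑' k, w k * h (x + d k)) s μ
      ≤ ∑' k, eLpNorm (fun x => w k * h (x + d k)) s μ :=
        eLpNorm_tsum_le hs fun k => ((hd k).const_mul _).aemeasurable
    _ ≤ ∑' k, w k * eLpNorm (fun x => h (x + d k)) s μ :=
        ENNReal.tsum_le_tsum fun k => eLpNorm_le_mul_eLpNorm_of_ae_le_mul'' s
          (hd k).aestronglyMeasurable (by simp)
    _ = (∑' k, w k) * eLpNorm h s μ := by
        rw [← ENNReal.tsum_mul_right]
        exact tsum_congr fun k => congrArg (w k * ·) (eLpNorm_comp_measurePreserving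
          hh.aestronglyMeasurable (measurePreserving_add_right μ (d k)))

theorem eLpNorm_comp_mul_left {κ : ℝ} (hκ : κ ≠ 0) (s : ℝ≥0∞) {h : ℝ → ℝ≥0∞} (hh : Measurable h) :
    eLpNorm (fun x => h (κ * x)) s volume =
      ENNReal.ofReal |κ⁻¹| ^ (1 / s).toReal * eLpNorm h s volume := by
  rw [← smul_eq_mul, ← eLpNorm_smul_measure_of_ne_zero (by simpa using hκ) h s volume,
    ← Real.map_volume_mul_left hκ, eLpNorm_map_measure hh.aestronglyMeasurable (by fun_prop)]
  rfl

theorem mul_measure_rpow_le_eLpNorm {s c : ℝ≥0∞} (hs : s ≠ 0) {E : Set X} (hE : MeasurableSet E)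
    (hE0 : μ E ≠ 0) {g : X → ℝ≥0∞} (h : ∀ x ∈ E, c ≤ g x) :
    c * μ E ^ (1 / s.toReal) ≤ eLpNorm g s μ :=
  calc c * μ E ^ (1 / s.toReal) = eLpNorm (fun _ => c) s (μ.restrict E) := by
        simp [eLpNorm_const c hs (Measure.restrict_eq_zero.not.2 hE0)]
    _ ≤ eLpNorm g s (μ.restrict E) :=
        eLpNorm_mono_enorm_ae ((ae_restrict_mem hE).mono fun x hx => h x hx)
    _ ≤ eLpNorm g s μ := eLpNorm_mono_measure _ Measure.restrict_le_self

end LpNorms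

section Rearrangement

variable {f g : ℝ → ℝ≥0∞} {l : ℝ≥0∞} {a t x y : ℝ}

theorem rearrangement_antitone (f : ℝ → ℝ≥0∞) : Antitone (rearrangement f) := fun _ _ h =>
  sInf_le_sInf fun _ hl => le_trans hl (ENNReal.ofReal_le_ofReal h)

theorem le_rearrangement_of_Ioc (hx : 0 ≤ x) (hxy : x < y) (ht : t < y - x)
    (h : ∀ z ∈ Ioc x y, l ≤ f z) : l ≤ rearrangement f t := by
  have halfLine_Ioc : halfLine (Ioc x y) = ENNReal.ofReal (y - x) := by
    rw [halfLine, Measure.restrict_apply measurableSet_Ioc,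
      inter_eq_left.2 (Ioc_subset_Ioi_self.trans (Ioi_subset_Ioi hx)), Real.volume_Ioc]
  refine le_sInf fun m hm => not_lt.1 fun hml => ?_
  have : halfLine (Ioc x y) ≤ ENNReal.ofReal t :=
    (measure_mono fun z hz => hml.trans_le (h z hz)).trans hm
  rw [halfLine_Ioc, ENNReal.ofReal_le_ofReal_iff'] at this
  grind

theorem rearrangement_le_of_antitoneOn (hg : AntitoneOn g (Ioi 0)) (hfg : ∀ t, 0 < t → f t ≤ g t)
    (ht : 0 < t) : rearrangement f t ≤ g t := by
  refine sInf_le ?_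
  rw [mem_ofPred_eq, halfLine, Measure.restrict_apply' measurableSet_Ioi]
  calc volume ({x | g t < f x} ∩ Ioi 0) ≤ volume (Ioc 0 t) :=
        measure_mono fun x hx => ⟨hx.2, not_lt.1 fun h =>
          (hx.1.trans_le ((hfg x hx.2).trans (hg ht hx.2 h.le))).false⟩
    _ = ENNReal.ofReal t := by simp

/-- The weighted rearrangement `t ^ a * f^*(t)` in the coordinate `x = log t`, in which Lorentz
functionals are `L^s` norms for Lebesgue measure on `ℝ` and dilations are translations. -/
def logRearrangement (a : ℝ) (f : ℝ → ℝ≥0∞) (x : ℝ) : ℝ≥0∞ :=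
  ENNReal.ofReal (Real.exp (a * x)) * rearrangement f (Real.exp x)

theorem measurable_logRearrangement (a : ℝ) (f : ℝ → ℝ≥0∞) : Measurable (logRearrangement a f) := by
  have := (rearrangement_antitone f).measurable
  unfold logRearrangement
  fun_prop

theorem ofReal_exp_mul (x y : ℝ) : ENNReal.ofReal (Real.exp x) * ENNReal.ofReal (Real.exp y) =
    ENNReal.ofReal (Real.exp (x + y)) := by
  rw [← ENNReal.ofReal_mul (Real.exp_nonneg _), Real.exp_add]

theorem ofReal_exp_rpow (x s : ℝ) :
    ENNReal.ofReal (Real.exp x) ^ s = ENNReal.ofReal (Real.exp (x * s)) := by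
  rw [ENNReal.ofReal_rpow_of_pos (Real.exp_pos x), Real.exp_mul]

theorem eLpNorm_logRearrangement {s : ℝ≥0∞} (hs : s ≠ 0) (hs' : s ≠ ∞) (a : ℝ) (f : ℝ → ℝ≥0∞)
    {A : Set ℝ} (hA : MeasurableSet A) :
    eLpNorm (logRearrangement a f) s (volume.restrict A) =
      (∫⁻ t in Real.exp '' A,
        ENNReal.ofReal (t ^ (a * s.toReal - 1)) * rearrangement f t ^ s.toReal)
          ^ (1 / s.toReal) := by
  rw [eLpNorm_eq_lintegral_rpow_enorm_toReal hs hs', lintegral_image_eq_lintegral_abs_deriv_mul hA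
    (fun x _ => (Real.hasDerivAt_exp x).hasDerivWithinAt) Real.exp_injective.injOn]
  congr! 3 with x
  rw [enorm_eq_self, logRearrangement, ENNReal.mul_rpow_of_nonneg _ _ ENNReal.toReal_nonneg,
    ofReal_exp_rpow, abs_of_pos (Real.exp_pos x), ← Real.exp_mul, ← mul_assoc, ofReal_exp_mul]
  congr 3
  ring

theorem mul_rearrangement_le_eLpNorm_logRearrangement (ha : 0 ≤ a) {s : ℝ≥0∞} (hs : s ≠ 0)
    (f : ℝ → ℝ≥0∞) {A : Set ℝ} (hA : IsLowerSet A) (hy : y ∈ A) (hxy : x < y) :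
    ENNReal.ofReal (Real.exp (a * x)) * rearrangement f (Real.exp y) *
        ENNReal.ofReal (y - x) ^ (1 / s.toReal) ≤
      eLpNorm (logRearrangement a f) s (volume.restrict A) := by
  have hsub : Ioc x y ⊆ A := fun z hz => hA hz.2 hy
  have measure_Ioc : volume.restrict A (Ioc x y) = ENNReal.ofReal (y - x) := by
    rw [Measure.restrict_apply measurableSet_Ioc, inter_eq_left.2 hsub, Real.volume_Ioc]
  rw [← measure_Ioc]
  refine mul_measure_rpow_le_eLpNorm hs measurableSet_Ioc (by simpa [measure_Ioc]) fun z hz => ?_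
  unfold logRearrangement
  gcongr
  · exact hz.1.le
  · exact rearrangement_antitone f (Real.exp_le_exp.2 hz.2)

theorem eLpNorm_logRearrangement_top (ha : 0 ≤ a) (f : ℝ → ℝ≥0∞) {A : Set ℝ} (hA : IsLowerSet A) :
    eLpNorm (logRearrangement a f) ∞ (volume.restrict A) =
      ⨆ t ∈ Real.exp '' A, ENNReal.ofReal (t ^ a) * rearrangement f t := by
  simp only [iSup_image, ← Real.exp_mul, mul_comm _ a]
  refine le_antisymm (essSup_le_of_ae_le _ ?_) (iSup₂_le fun x hx => ?_)
  · filter_upwards [ae_restrict_mem hA.ordConnected.measurableSet] with x hx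
    exact le_iSup₂_of_le x hx le_rfl
  have tendsto_left : Tendsto
      (fun z => ENNReal.ofReal (Real.exp (a * z)) * rearrangement f (Real.exp x)) (𝓝[<] x)
      (𝓝 (ENNReal.ofReal (Real.exp (a * x)) * rearrangement f (Real.exp x))) :=
    ENNReal.Tendsto.mul_const (((ENNReal.continuous_ofReal.comp (by fun_prop :
      Continuous fun z => Real.exp (a * z))).tendsto x).mono_left nhdsWithin_le_nhds)
      (Or.inl (ENNReal.ofReal_pos.2 (Real.exp_pos _)).ne')
  refine le_of_tendsto tendsto_left (eventually_nhdsWithin_of_forall fun z hz => ?_)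
  simpa using mul_rearrangement_le_eLpNorm_logRearrangement ha ENNReal.top_ne_zero f hA hx hz

theorem lorentzNorm_eq_eLpNorm {r s : ℝ≥0∞} (hs : s ≠ 0) (f : ℝ → ℝ≥0∞) :
    lorentzNorm r s f = eLpNorm (logRearrangement r⁻¹.toReal f) s volume := by
  rw [← Measure.restrict_univ (μ := volume), lorentzNorm]
  split_ifs with hs'
  · rw [hs', eLpNorm_logRearrangement_top ENNReal.toReal_nonneg f isLowerSet_univ, image_univ,
      Real.range_exp]
  have hpos := ENNReal.toReal_pos hs hs'
  rw [eLpNorm_logRearrangement hs hs' _ f MeasurableSet.univ, image_univ, Real.range_exp]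
  congr 1
  refine setLIntegral_congr_fun measurableSet_Ioi fun t (ht : 0 < t) => ?_
  simp only [ENNReal.mul_rpow_of_nonneg _ _ hpos.le,
    ENNReal.ofReal_rpow_of_pos (Real.rpow_pos_of_pos ht _), ← Real.rpow_mul ht.le, sub_mul,
    ENNReal.toReal_inv, inv_mul_cancel₀ hpos.ne']

theorem localLorentz_exp {p : ℝ} (hp : 0 < p) {q₀ : ℝ≥0∞} (hq₀ : q₀ ≠ 0) (f : ℝ → ℝ≥0∞) (y : ℝ) :
    localLorentz p q₀ f (Real.exp y) =
      eLpNorm (logRearrangement (1 / p) f) q₀ (volume.restrict (Iic y)) := by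
  unfold localLorentz
  split_ifs with hq₀'
  · rw [hq₀', eLpNorm_logRearrangement_top (by positivity) f (isLowerSet_Iic y), Real.image_exp_Iic]
  · rw [eLpNorm_logRearrangement hq₀ hq₀' _ f measurableSet_Iic, Real.image_exp_Iic,
      one_div_mul_eq_div]

end Rearrangement

section UpperBounds

variable {a c y δ : ℝ} {q₀ s s₁ s₂ : ℝ≥0∞}

theorem logRearrangement_le_eLpNorm (ha : 0 ≤ a) (hs : s ≠ 0) (f : ℝ → ℝ≥0∞) {A : Set ℝ}
    (hA : IsLowerSet A) (hy : y ∈ A) :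
    logRearrangement a f y ≤
      ENNReal.ofReal (Real.exp a) * eLpNorm (logRearrangement a f) s (volume.restrict A) :=
  calc logRearrangement a f y
      = ENNReal.ofReal (Real.exp a) *
          (ENNReal.ofReal (Real.exp (a * (y - 1))) * rearrangement f (Real.exp y)) := by
        rw [logRearrangement, ← mul_assoc, ofReal_exp_mul]
        ring_nf
    _ ≤ _ := by
        gcongr
        simpa using mul_rearrangement_le_eLpNorm_logRearrangement ha hs f hA hy (sub_one_lt y)

theorem eLpNorm_logRearrangement_le_of_exponent_le (ha : 0 ≤ a) (hs₁ : s₁ ≠ 0) (hs : s₁ ≤ s₂)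
    (f : ℝ → ℝ≥0∞) {A : Set ℝ} (hA : IsLowerSet A) :
    eLpNorm (logRearrangement a f) s₂ (volume.restrict A) ≤
      ENNReal.ofReal (Real.exp a) * eLpNorm (logRearrangement a f) s₁ (volume.restrict A) :=
  eLpNorm_le_const_mul_of_ae_le hs₁ hs (by simpa using Real.one_le_exp ha)
    ((ae_restrict_mem hA.ordConnected.measurableSet).mono fun _ hx =>
      logRearrangement_le_eLpNorm ha hs₁ f hA hx)

theorem iUnion_Ioc_sub_natCast (y : ℝ) : ⋃ k : ℕ, Ioc (y - (k + 1)) (y - k) = Iic y := by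
  ext x
  simp only [mem_iUnion, mem_Ioc, mem_Iic]
  refine ⟨fun ⟨k, hk⟩ => hk.2.trans (sub_le_self y k.cast_nonneg), fun hx => ⟨⌊y - x⌋₊, ?_, ?_⟩⟩
  · linarith [Nat.lt_floor_add_one (y - x)]
  · linarith [Nat.floor_le (sub_nonneg.2 hx)]

theorem eLpNorm_logRearrangement_Iic_le_tsum (hc : 0 ≤ c) (hq₀ : 1 ≤ q₀) (f : ℝ → ℝ≥0∞) (y : ℝ) :
    eLpNorm (logRearrangement c f) q₀ (volume.restrict (Iic y)) ≤
      ENNReal.ofReal (Real.exp (2 * c)) * ∑' k : ℕ, logRearrangement c f (y + -(k + 1)) := by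
  have integral_le : ∀ k : ℕ, ∫⁻ x in Ioc (y - (k + 1)) (y - k), logRearrangement c f x ≤
      ENNReal.ofReal (Real.exp c) * logRearrangement c f (y + -(k + 1)) := fun k =>
    calc ∫⁻ x in Ioc (y - (k + 1)) (y - k), logRearrangement c f x
        ≤ ∫⁻ _ in Ioc (y - (k + 1)) (y - k), ENNReal.ofReal (Real.exp (c * (y - k))) *
            rearrangement f (Real.exp (y - (k + 1))) := by
          refine setLIntegral_mono' measurableSet_Ioc fun x hx => ?_
          unfold logRearrangement
          gcongr
          · exact hx.2
          · exact rearrangement_antitone f (Real.exp_le_exp.2 hx.1.le)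
      _ = _ := by
          rw [logRearrangement, ← mul_assoc, ofReal_exp_mul, setLIntegral_const, Real.volume_Ioc]
          ring_nf
          simp
  calc eLpNorm (logRearrangement c f) q₀ (volume.restrict (Iic y))
      ≤ ENNReal.ofReal (Real.exp c) * ∫⁻ x in Iic y, logRearrangement c f x := by
        simpa [eLpNorm_one_eq_lintegral_enorm] using
          eLpNorm_logRearrangement_le_of_exponent_le hc one_ne_zero hq₀ f (isLowerSet_Iic y)
    _ ≤ ENNReal.ofReal (Real.exp c) *
          ∑' k : ℕ, ENNReal.ofReal (Real.exp c) * logRearrangement c f (y + -(k + 1)) := by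
        rw [← iUnion_Ioc_sub_natCast]
        gcongr
        exact (lintegral_iUnion_le _ _).trans (ENNReal.tsum_le_tsum integral_le)
    _ = _ := by rw [ENNReal.tsum_mul_left, ← mul_assoc, ofReal_exp_mul, two_mul]

theorem tsum_ofReal_exp_neg_ne_top (hδ : 0 < δ) :
    ∑' k : ℕ, ENNReal.ofReal (Real.exp (-(δ * (k + 1)))) ≠ ∞ := by
  have : ∀ k : ℕ, ENNReal.ofReal (Real.exp (-(δ * (k + 1)))) =
      ENNReal.ofReal (Real.exp (-δ)) ^ (k + 1) := fun k => by
    rw [← ENNReal.ofReal_pow (Real.exp_nonneg _), ← Real.exp_nat_mul]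
    push_cast
    ring_nf
  simp only [this, ENNReal.tsum_geometric_add_one]
  have : ENNReal.ofReal (Real.exp (-δ)) < 1 := by simpa using hδ
  finiteness [(tsub_pos_of_lt this).ne']

theorem hardy_inequality (hc : 0 ≤ a + δ) (hq₀ : 1 ≤ q₀) (hs : 1 ≤ s) (f : ℝ → ℝ≥0∞) :
    eLpNorm (fun y => ENNReal.ofReal (Real.exp (-(δ * y))) *
        eLpNorm (logRearrangement (a + δ) f) q₀ (volume.restrict (Iic y))) s volume ≤
      ENNReal.ofReal (Real.exp (2 * (a + δ))) *
        (∑' k : ℕ, ENNReal.ofReal (Real.exp (-(δ * (k + 1))))) *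
          eLpNorm (logRearrangement a f) s volume := by
  have shift : ∀ (y : ℝ) (k : ℕ), ENNReal.ofReal (Real.exp (-(δ * y))) *
      logRearrangement (a + δ) f (y + -(k + 1)) =
        ENNReal.ofReal (Real.exp (-(δ * (k + 1)))) * logRearrangement a f (y + -(k + 1)) := by
    intro y k
    simp only [logRearrangement, ← mul_assoc, ofReal_exp_mul]
    ring_nf
  calc eLpNorm (fun y => ENNReal.ofReal (Real.exp (-(δ * y))) *
        eLpNorm (logRearrangement (a + δ) f) q₀ (volume.restrict (Iic y))) s volume
      ≤ ENNReal.ofReal (Real.exp (2 * (a + δ))) * eLpNorm (fun y => ∑' k : ℕ,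
          ENNReal.ofReal (Real.exp (-(δ * (k + 1)))) *
            logRearrangement a f (y + -(k + 1))) s volume := by
        refine eLpNorm_le_mul_eLpNorm_of_ae_le_mul' (ae_of_all _ fun y => ?_) s
        simp only [enorm_eq_self, ← shift, ENNReal.tsum_mul_left]
        rw [mul_left_comm]
        gcongr
        exact eLpNorm_logRearrangement_Iic_le_tsum hc hq₀ f y
    _ ≤ _ := by
        rw [mul_assoc]
        gcongr
        exact eLpNorm_tsum_translate_le hs _ _ (measurable_logRearrangement a f)

end UpperBounds

section QuasiMonotone

variable {α b x : ℝ} {s : ℝ≥0∞} {T : ℝ → ℝ≥0∞}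

/-- The functions `T` on `(0, ∞)` for which `t ^ α * T t` is non-decreasing, expressed in the
coordinate `x = log t`. Up to constants, Lorentz functionals of such functions can be computed
without rearranging them. -/
def QuasiIncreasing (α : ℝ) (T : ℝ → ℝ≥0∞) : Prop :=
  Monotone fun x => ENNReal.ofReal (Real.exp (α * x)) * T (Real.exp x)

theorem QuasiIncreasing.ofReal_exp_neg_mul_le (hT : QuasiIncreasing α T)
    (hα : 0 ≤ α) {y : ℝ} (hxy : x ≤ y) (hyx : y ≤ x + 1) :
    ENNReal.ofReal (Real.exp (-α)) * T (Real.exp x) ≤ T (Real.exp y) :=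
  calc ENNReal.ofReal (Real.exp (-α)) * T (Real.exp x)
      ≤ ENNReal.ofReal (Real.exp (-(α * y) + α * x)) * T (Real.exp x) := by
        gcongr
        nlinarith
    _ = ENNReal.ofReal (Real.exp (-(α * y))) *
          (ENNReal.ofReal (Real.exp (α * x)) * T (Real.exp x)) := by
        rw [← mul_assoc, ofReal_exp_mul]
    _ ≤ ENNReal.ofReal (Real.exp (-(α * y))) *
          (ENNReal.ofReal (Real.exp (α * y)) * T (Real.exp y)) := by
        exact mul_le_mul_right (hT hxy) _
    _ = T (Real.exp y) := by rw [← mul_assoc, ofReal_exp_mul]; simp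

theorem QuasiIncreasing.le_rearrangement (hT : QuasiIncreasing α T)
    (hα : 0 ≤ α) (x : ℝ) :
    ENNReal.ofReal (Real.exp (-α)) * T (Real.exp x) ≤ rearrangement T (Real.exp x) := by
  have hlt : Real.exp x < Real.exp (x + 1) - Real.exp x := by
    rw [Real.exp_add]
    nlinarith [Real.exp_pos x, Real.exp_one_gt_d9]
  refine le_rearrangement_of_Ioc (Real.exp_nonneg x) (by linarith [Real.exp_pos x]) hlt
    fun z hz => ?_
  have hz0 := (Real.exp_pos x).trans hz.1
  rw [← Real.exp_log hz0]
  exact hT.ofReal_exp_neg_mul_le hα ((Real.le_log_iff_exp_le hz0).2 hz.1.le)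
    ((Real.log_le_iff_le_exp hz0).2 hz.2)

theorem ofReal_exp_mul_ofReal_exp_neg_mul (α : ℝ) (c : ℝ≥0∞) :
    ENNReal.ofReal (Real.exp α) * (ENNReal.ofReal (Real.exp (-α)) * c) = c := by
  rw [← mul_assoc, ofReal_exp_mul]
  simp

theorem QuasiIncreasing.eLpNorm_le_eLpNorm_logRearrangement (hT : QuasiIncreasing α T)
    (hα : 0 ≤ α) (b : ℝ) (s : ℝ≥0∞) :
    eLpNorm (fun x => ENNReal.ofReal (Real.exp (b * x)) * T (Real.exp x)) s volume ≤
      ENNReal.ofReal (Real.exp α) * eLpNorm (logRearrangement b T) s volume := by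
  refine eLpNorm_le_mul_eLpNorm_of_ae_le_mul' (ae_of_all _ fun x => ?_) s
  rw [enorm_eq_self, enorm_eq_self, logRearrangement, mul_left_comm,
    ← ofReal_exp_mul_ofReal_exp_neg_mul α (T (Real.exp x))]
  change _ ≤ _ * (ENNReal.ofReal (Real.exp α) * _)
  gcongr
  exact hT.le_rearrangement hα x

theorem QuasiIncreasing.rearrangement_le_iSup (hT : QuasiIncreasing α T)
    (hα : 0 ≤ α) (x : ℝ) :
    rearrangement T (Real.exp x) ≤
      ENNReal.ofReal (Real.exp α) * ⨆ k : ℕ, T (Real.exp (x + (k + 1))) := by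
  have least_decreasing_majorant : rearrangement T (Real.exp x) ≤ ⨆ v ∈ Ici (Real.exp x), T v :=
    rearrangement_le_of_antitoneOn (g := fun t => ⨆ v ∈ Ici t, T v)
      (fun _ _ _ _ h => biSup_mono fun _ => h.trans)
      (fun t _ => le_iSup₂_of_le t self_mem_Ici le_rfl) (Real.exp_pos x)
  refine least_decreasing_majorant.trans (iSup₂_le fun v (hv : _ ≤ v) => ?_)
  obtain ⟨w, rfl⟩ : ∃ w, v = Real.exp w := ⟨_, (Real.exp_log ((Real.exp_pos x).trans_le hv)).symm⟩
  have hxw : 0 ≤ w - x := sub_nonneg.2 (Real.exp_le_exp.1 hv)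
  have hle : w ≤ x + (⌊w - x⌋₊ + 1) := by linarith [Nat.lt_floor_add_one (w - x)]
  calc T (Real.exp w) = ENNReal.ofReal (Real.exp α) *
          (ENNReal.ofReal (Real.exp (-α)) * T (Real.exp w)) :=
        (ofReal_exp_mul_ofReal_exp_neg_mul α _).symm
    _ ≤ ENNReal.ofReal (Real.exp α) * T (Real.exp (x + (⌊w - x⌋₊ + 1))) := by
        gcongr
        exact hT.ofReal_exp_neg_mul_le hα hle (by linarith [Nat.floor_le hxw])
    _ ≤ _ := by
        gcongr
        exact le_iSup (fun k : ℕ => T (Real.exp (x + (k + 1)))) _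

theorem QuasiIncreasing.logRearrangement_le_iSup (hT : QuasiIncreasing α T)
    (hα : 0 ≤ α) (b x : ℝ) :
    logRearrangement b T x ≤ ENNReal.ofReal (Real.exp α) * ⨆ k : ℕ,
      ENNReal.ofReal (Real.exp (-(b * (k + 1)))) *
        (ENNReal.ofReal (Real.exp (b * (x + (k + 1)))) * T (Real.exp (x + (k + 1)))) := by
  calc logRearrangement b T x ≤ ENNReal.ofReal (Real.exp (b * x)) *
        (ENNReal.ofReal (Real.exp α) * ⨆ k : ℕ, T (Real.exp (x + (k + 1)))) := by
        unfold logRearrangement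
        gcongr
        exact hT.rearrangement_le_iSup hα x
    _ = _ := by
        rw [mul_left_comm, ENNReal.mul_iSup]
        simp only [← mul_assoc, ofReal_exp_mul]
        ring_nf

theorem QuasiIncreasing.measurable (hT : QuasiIncreasing α T) (b : ℝ) :
    Measurable fun x => ENNReal.ofReal (Real.exp (b * x)) * T (Real.exp x) := by
  have hm := Monotone.measurable hT
  have : (fun x => ENNReal.ofReal (Real.exp (b * x)) * T (Real.exp x)) = fun x =>
      ENNReal.ofReal (Real.exp ((b - α) * x)) *
        (ENNReal.ofReal (Real.exp (α * x)) * T (Real.exp x)) := by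
    ext x
    rw [← mul_assoc, ofReal_exp_mul]
    ring_nf
  rw [this]
  fun_prop

theorem QuasiIncreasing.eLpNorm_logRearrangement_top_le (hT : QuasiIncreasing α T) (hα : 0 ≤ α)
    (hb : 0 ≤ b) :
    eLpNorm (logRearrangement b T) ∞ volume ≤ ENNReal.ofReal (Real.exp α) *
      eLpNorm (fun x => ENNReal.ofReal (Real.exp (b * x)) * T (Real.exp x)) ∞ volume := by
  set h := fun x => ENNReal.ofReal (Real.exp (b * x)) * T (Real.exp x)
  have translate_le : ∀ᵐ x, ∀ k : ℕ, h (x + (k + 1)) ≤ eLpNorm h ∞ volume := by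
    refine ae_all_iff.2 fun k => ?_
    have := (measurePreserving_add_right volume (k + 1 : ℝ)).quasiMeasurePreserving.ae
      (enorm_ae_le_eLpNormEssSup h volume)
    simpa using this
  refine essSup_le_of_ae_le _ (translate_le.mono fun x hx => ?_)
  refine (hT.logRearrangement_le_iSup hα b x).trans (mul_le_mul_right (iSup_le fun k => ?_) _)
  have weight_le_one : ENNReal.ofReal (Real.exp (-(b * (k + 1)))) ≤ 1 := by
    simpa using mul_nonneg hb (by positivity : (0 : ℝ) ≤ k + 1)
  exact (mul_le_of_le_one_left' weight_le_one).trans (hx k)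

theorem QuasiIncreasing.eLpNorm_logRearrangement_le (hT : QuasiIncreasing α T) (hα : 0 ≤ α)
    (hs : 1 ≤ s) :
    eLpNorm (logRearrangement b T) s volume ≤
      ENNReal.ofReal (Real.exp α) * (∑' k : ℕ, ENNReal.ofReal (Real.exp (-(b * (k + 1))))) *
        eLpNorm (fun x => ENNReal.ofReal (Real.exp (b * x)) * T (Real.exp x)) s volume := by
  have h_measurable := hT.measurable b
  have le_iSup := hT.logRearrangement_le_iSup hα b
  set h := fun x => ENNReal.ofReal (Real.exp (b * x)) * T (Real.exp x)
  let w : ℕ → ℝ≥0∞ := fun k => ENNReal.ofReal (Real.exp (-(b * (k + 1))))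
  calc eLpNorm (logRearrangement b T) s volume
      ≤ ENNReal.ofReal (Real.exp α) *
          eLpNorm (fun x => ∑' k, w k * h (x + ((k : ℝ) + 1))) s volume := by
        refine eLpNorm_le_mul_eLpNorm_of_ae_le_mul' (ae_of_all _ fun x => ?_) s
        exact (le_iSup x).trans (mul_le_mul_right (iSup_le fun k => ENNReal.le_tsum k) _)
    _ ≤ _ := by
        rw [mul_assoc]
        gcongr
        exact eLpNorm_tsum_translate_le hs w (fun k => (k : ℝ) + 1) h_measurable

theorem exists_eLpNorm_logRearrangement_le (hα : 0 ≤ α) (hb : 0 ≤ b) (hs : 1 ≤ s)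
    (hbs : s ≠ ∞ → 0 < b) :
    ∃ C : ℝ≥0, ∀ T, QuasiIncreasing α T → eLpNorm (logRearrangement b T) s volume ≤
      C * eLpNorm (fun x => ENNReal.ofReal (Real.exp (b * x)) * T (Real.exp x)) s volume := by
  obtain rfl | hs' := eq_or_ne s ∞
  · exact ⟨_, fun T hT => hT.eLpNorm_logRearrangement_top_le hα hb⟩
  have hC := ENNReal.mul_ne_top (ENNReal.ofReal_ne_top (r := Real.exp α))
    (tsum_ofReal_exp_neg_ne_top (hbs hs'))
  refine ⟨(ENNReal.ofReal (Real.exp α) *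
    ∑' k : ℕ, ENNReal.ofReal (Real.exp (-(b * (k + 1))))).toNNReal, fun T hT => ?_⟩
  rw [ENNReal.coe_toNNReal hC]
  exact hT.eLpNorm_logRearrangement_le hα hs

end QuasiMonotone

section HardyOperator

variable {a α b κ p : ℝ} {q₀ s s₁ s₂ : ℝ≥0∞}

/-- The Lorentz functional `‖·‖_{r,s}` as a function of `a = 1 / r`, in the coordinate `log t`. -/
def logLorentzNorm (a : ℝ) (s : ℝ≥0∞) (f : ℝ → ℝ≥0∞) : ℝ≥0∞ :=
  eLpNorm (logRearrangement a f) s volume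

theorem logLorentzNorm_le_of_exponent_le (ha : 0 ≤ a) (hs₁ : s₁ ≠ 0) (hs : s₁ ≤ s₂)
    (f : ℝ → ℝ≥0∞) :
    logLorentzNorm a s₂ f ≤ ENNReal.ofReal (Real.exp a) * logLorentzNorm a s₁ f := by
  simpa [logLorentzNorm] using
    eLpNorm_logRearrangement_le_of_exponent_le ha hs₁ hs f isLowerSet_univ

/-- The operator `f ↦ t^{-α} (∫_0^{t^κ} s^{q₀/p - 1} f^*(s)^{q₀} ds)^{1/q₀}`, the common form of
`opR p₀ p₁ q q₀`, where `α = 1 / p₁`, `κ = rExp p₀ p₁ q` and `p = p₀`, and of the function measured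
by `angleNorm ρ p q₀`, where `α = 1 / p` and `κ = 1`. -/
def hardyOp (α κ p : ℝ) (q₀ : ℝ≥0∞) (f : ℝ → ℝ≥0∞) (t : ℝ) : ℝ≥0∞ :=
  ENNReal.ofReal (t ^ (-α)) * localLorentz p q₀ f (t ^ κ)

theorem hardyOp_exp (hp : 0 < p) (hq₀ : q₀ ≠ 0) (α κ : ℝ) (f : ℝ → ℝ≥0∞) (x : ℝ) :
    hardyOp α κ p q₀ f (Real.exp x) = ENNReal.ofReal (Real.exp (-(α * x))) *
      eLpNorm (logRearrangement (1 / p) f) q₀ (volume.restrict (Iic (κ * x))) := by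
  rw [hardyOp, ← Real.exp_mul, ← Real.exp_mul, localLorentz_exp hp hq₀]
  ring_nf

theorem ofReal_exp_mul_hardyOp (hp : 0 < p) (hq₀ : q₀ ≠ 0) (α κ b : ℝ) (f : ℝ → ℝ≥0∞) (x : ℝ) :
    ENNReal.ofReal (Real.exp (b * x)) * hardyOp α κ p q₀ f (Real.exp x) =
      ENNReal.ofReal (Real.exp ((b - α) * x)) *
        eLpNorm (logRearrangement (1 / p) f) q₀ (volume.restrict (Iic (κ * x))) := by
  rw [hardyOp_exp hp hq₀, ← mul_assoc, ofReal_exp_mul]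
  ring_nf

theorem monotone_eLpNorm_logRearrangement_Iic (a : ℝ) (s : ℝ≥0∞) (f : ℝ → ℝ≥0∞) :
    Monotone fun y => eLpNorm (logRearrangement a f) s (volume.restrict (Iic y)) :=
  fun _ _ h => eLpNorm_mono_measure _ (Measure.restrict_mono (Iic_subset_Iic.2 h) le_rfl)

theorem quasiIncreasing_hardyOp (hp : 0 < p) (hq₀ : q₀ ≠ 0) (hκ : 0 ≤ κ) (α : ℝ)
    (f : ℝ → ℝ≥0∞) : QuasiIncreasing α (hardyOp α κ p q₀ f) := by
  intro x y hxy
  simp only [ofReal_exp_mul_hardyOp hp hq₀, sub_self, zero_mul, Real.exp_zero, ENNReal.ofReal_one,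
    one_mul]
  exact monotone_eLpNorm_logRearrangement_Iic _ _ _ (mul_le_mul_of_nonneg_left hxy hκ)

theorem exists_eLpNorm_ofReal_exp_mul_hardyOp_le (hκ : κ ≠ 0) (hp : 0 < p) (hq₀ : 1 ≤ q₀)
    (hs : 1 ≤ s) (hap : a < 1 / p) (hab : κ * (1 / p - a) = α - b) :
    ∃ C : ℝ≥0, ∀ f, eLpNorm (fun x => ENNReal.ofReal (Real.exp (b * x)) *
      hardyOp α κ p q₀ f (Real.exp x)) s volume ≤ C * logLorentzNorm a s f := by
  have hD := ENNReal.mul_ne_top (ENNReal.ofReal_ne_top (r := Real.exp (2 * (1 / p))))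
    (tsum_ofReal_exp_neg_ne_top (sub_pos.2 hap))
  set D := ENNReal.ofReal (Real.exp (2 * (1 / p))) *
    ∑' k : ℕ, ENNReal.ofReal (Real.exp (-((1 / p - a) * (k + 1)))) with hD'
  set J := ENNReal.ofReal |κ⁻¹| ^ (1 / s).toReal
  refine ⟨(J * D).toNNReal, fun f => ?_⟩
  rw [ENNReal.coe_toNNReal (by finiteness), mul_assoc]
  have hardy := hardy_inequality (a := a) (δ := 1 / p - a) (by rw [add_sub_cancel]; positivity)
    hq₀ hs f
  rw [add_sub_cancel, ← hD'] at hardy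
  set H : ℝ → ℝ≥0∞ := fun y => ENNReal.ofReal (Real.exp (-((1 / p - a) * y))) *
    eLpNorm (logRearrangement (1 / p) f) q₀ (volume.restrict (Iic y)) with hH
  have H_measurable : Measurable H := by
    have := (monotone_eLpNorm_logRearrangement_Iic (1 / p) q₀ f).measurable
    fun_prop
  have eq_comp :
      (fun x => ENNReal.ofReal (Real.exp (b * x)) * hardyOp α κ p q₀ f (Real.exp x)) =
        fun x => H (κ * x) := by
    ext x
    rw [ofReal_exp_mul_hardyOp hp (one_pos.trans_le hq₀).ne', hH]
    congr 3
    linear_combination x * hab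
  rw [eq_comp, eLpNorm_comp_mul_left hκ _ H_measurable]
  exact mul_le_mul_right hardy _

theorem exists_logLorentzNorm_hardyOp_le (hα : 0 ≤ α) (hκ : 0 < κ) (hp : 0 < p) (hq₀ : 1 ≤ q₀)
    (hs₁ : 1 ≤ s₁) (hs : s₁ ≤ s₂) (ha : 0 ≤ a) (hap : a < 1 / p)
    (hab : κ * (1 / p - a) = α - b) (hb : 0 ≤ b) (hbs : s₂ ≠ ∞ → 0 < b) :
    ∃ C : ℝ≥0, ∀ f, logLorentzNorm b s₂ (hardyOp α κ p q₀ f) ≤ C * logLorentzNorm a s₁ f := by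
  have hs₂ : 1 ≤ s₂ := hs₁.trans hs
  obtain ⟨C, hC⟩ := exists_eLpNorm_logRearrangement_le hα hb hs₂ hbs
  obtain ⟨D, hD⟩ := exists_eLpNorm_ofReal_exp_mul_hardyOp_le hκ.ne' hp hq₀ hs₂ hap hab
  refine ⟨C * D * (Real.exp a).toNNReal, fun f => ?_⟩
  calc logLorentzNorm b s₂ (hardyOp α κ p q₀ f)
      ≤ C * (D * logLorentzNorm a s₂ f) :=
        (hC _ (quasiIncreasing_hardyOp hp (one_pos.trans_le hq₀).ne' hκ.le α f)).trans
          (mul_le_mul_right (hD f) _)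
    _ ≤ C * (D * (ENNReal.ofReal (Real.exp a) * logLorentzNorm a s₁ f)) := by
        gcongr
        exact logLorentzNorm_le_of_exponent_le ha (one_pos.trans_le hs₁).ne' hs f
    _ = _ := by simp only [ENNReal.coe_mul, mul_assoc, ENNReal.ofReal]

theorem exists_logLorentzNorm_hardyOp_endpoint_le (hα : 0 ≤ α) (hκ : 0 ≤ κ) (hp : 0 < p)
    (hs₁ : s₁ ≠ 0) (hs : s₁ ≤ q₀) :
    ∃ C : ℝ≥0, ∀ f, logLorentzNorm α ∞ (hardyOp α κ p q₀ f) ≤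
      C * logLorentzNorm (1 / p) s₁ f := by
  have hq₀ := ne_bot_of_le_ne_bot hs₁ hs
  obtain ⟨C, hC⟩ := exists_eLpNorm_logRearrangement_le hα hα le_top (by simp)
  refine ⟨C * (Real.exp (1 / p)).toNNReal, fun f => ?_⟩
  have norm_le : eLpNorm (fun x => ENNReal.ofReal (Real.exp (α * x)) *
      hardyOp α κ p q₀ f (Real.exp x)) ∞ volume ≤ logLorentzNorm (1 / p) q₀ f := by
    refine essSup_le_of_ae_le _ (ae_of_all _ fun x => ?_)
    simp only [enorm_eq_self, ofReal_exp_mul_hardyOp hp hq₀, sub_self, zero_mul, Real.exp_zero,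
      ENNReal.ofReal_one, one_mul]
    exact eLpNorm_mono_measure _ Measure.restrict_le_self
  calc logLorentzNorm α ∞ (hardyOp α κ p q₀ f)
      ≤ C * logLorentzNorm (1 / p) q₀ f :=
        (hC _ (quasiIncreasing_hardyOp hp hq₀ hκ α f)).trans (mul_le_mul_right norm_le _)
    _ ≤ _ := by
        rw [ENNReal.coe_mul, mul_assoc]
        gcongr
        exact logLorentzNorm_le_of_exponent_le (by positivity) hs₁ hs f

theorem logRearrangement_le_hardyOp (hp : 0 < p) (hq₀ : q₀ ≠ 0)
    (hab : κ * (1 / p - a) = α - b) (f : ℝ → ℝ≥0∞) (x : ℝ) :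
    logRearrangement a f (κ * x) ≤ ENNReal.ofReal (Real.exp (1 / p)) *
      (ENNReal.ofReal (Real.exp (b * x)) * hardyOp α κ p q₀ f (Real.exp x)) :=
  calc logRearrangement a f (κ * x)
      = ENNReal.ofReal (Real.exp ((b - α) * x)) * logRearrangement (1 / p) f (κ * x) := by
        simp only [logRearrangement, ← mul_assoc, ofReal_exp_mul]
        congr 3
        linear_combination -x * hab
    _ ≤ _ := by
        rw [ofReal_exp_mul_hardyOp hp hq₀, mul_left_comm]
        gcongr
        exact logRearrangement_le_eLpNorm (by positivity) hq₀ f (isLowerSet_Iic _) self_mem_Iic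

theorem exists_logLorentzNorm_le_hardyOp (hα : 0 ≤ α) (hκ : 0 < κ) (hp : 0 < p) (hq₀ : q₀ ≠ 0)
    (hab : κ * (1 / p - a) = α - b) (s : ℝ≥0∞) :
    ∃ C : ℝ≥0, ∀ f, logLorentzNorm a s f ≤ C * logLorentzNorm b s (hardyOp α κ p q₀ f) := by
  set J := ENNReal.ofReal |κ⁻¹| ^ (1 / s).toReal with hJ
  have hJ_ne_zero : J ≠ 0 := by
    refine (ENNReal.rpow_pos ?_ ENNReal.ofReal_ne_top).ne'
    simpa using hκ.ne'
  have hJ_ne_top : J ≠ ∞ := by finiteness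
  refine ⟨(J⁻¹ * (ENNReal.ofReal (Real.exp (1 / p)) * ENNReal.ofReal (Real.exp α))).toNNReal,
    fun f => ?_⟩
  rw [ENNReal.coe_toNNReal (by finiteness), mul_assoc, ← ENNReal.mul_le_iff_le_inv hJ_ne_zero
    hJ_ne_top, logLorentzNorm, hJ,
    ← eLpNorm_comp_mul_left hκ.ne' s (measurable_logRearrangement a f), mul_assoc]
  have quasiIncreasing := quasiIncreasing_hardyOp (q₀ := q₀) hp hq₀ hκ.le α f
  exact (eLpNorm_le_mul_eLpNorm_of_ae_le_mul' (ae_of_all _ fun x => by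
      rw [enorm_eq_self, enorm_eq_self]
      exact logRearrangement_le_hardyOp hp hq₀ hab f x) s).trans
    (mul_le_mul_right (quasiIncreasing.eLpNorm_le_eLpNorm_logRearrangement hα b s) _)

end HardyOperator

section Necessity

variable {a b d t α κ p : ℝ} {q₀ s s₁ s₂ : ℝ≥0∞}

theorem rearrangement_eq_of_antitoneOn {g : ℝ → ℝ≥0∞} (hg : AntitoneOn g (Ioi 0)) (ht : 0 < t)
    (hc : ContinuousWithinAt g (Ioi t) t) : rearrangement g t = g t := by
  refine (rearrangement_le_of_antitoneOn hg (fun _ _ => le_rfl) ht).antisymm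
    (le_of_tendsto hc (eventually_nhdsWithin_of_forall fun u (hu : t < u) => ?_))
  exact le_rearrangement_of_Ioc le_rfl (ht.trans hu) (by simpa using hu)
    fun z hz => hg hz.1 (ht.trans hu) hz.2

theorem rearrangement_indicator_Iio {g : ℝ → ℝ≥0∞} (hg : AntitoneOn g (Ioi 0))
    (hc : ContinuousOn g (Ioi 0)) (c : ℝ) (ht : 0 < t) :
    rearrangement ((Iio c).indicator g) t = (Iio c).indicator g t := by
  refine rearrangement_eq_of_antitoneOn (fun x hx y hy hxy => ?_) ht ?_
  · by_cases hyc : y < c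
    · simpa [indicator_of_mem, hyc, hxy.trans_lt hyc] using hg hx hy hxy
    · simp [hyc]
  obtain htc | hct := lt_or_ge t c
  · have eventually_eq : (Iio c).indicator g =ᶠ[𝓝 t] g :=
      eventuallyEq_of_mem (Iio_mem_nhds htc) (eqOn_indicator (s := Iio c))
    exact ((hc.continuousAt (Ioi_mem_nhds ht)).congr eventually_eq.symm).continuousWithinAt
  · have eq_zero : ∀ x, c ≤ x → (Iio c).indicator g x = 0 := fun x hx =>
      indicator_of_notMem (notMem_Iio.2 hx) g
    exact (continuousWithinAt_const (b := 0)).congr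
      (fun x hx => eq_zero x (hct.trans (le_of_lt hx))) (eq_zero t hct)

theorem logRearrangement_indicator_Iio {g : ℝ → ℝ≥0∞} (hg : AntitoneOn g (Ioi 0))
    (hc : ContinuousOn g (Ioi 0)) (a ξ x : ℝ) :
    logRearrangement a ((Iio (Real.exp ξ)).indicator g) x =
      (Iio ξ).indicator (fun x => ENNReal.ofReal (Real.exp (a * x)) * g (Real.exp x)) x := by
  rw [logRearrangement, rearrangement_indicator_Iio hg hc _ (Real.exp_pos x)]
  simp [indicator_apply]

theorem logRearrangement_indicator_Iio_one (a ξ x : ℝ) :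
    logRearrangement a ((Iio (Real.exp ξ)).indicator 1) x =
      (Iio ξ).indicator (fun x => ENNReal.ofReal (Real.exp (a * x))) x := by
  rw [logRearrangement_indicator_Iio (g := 1) antitoneOn_const continuousOn_const]
  simp

theorem eLpNorm_indicator_Iio_exp_ne_top (ha : 0 ≤ a) (hs : s ≠ 0) (has : s ≠ ∞ → 0 < a) :
    eLpNorm ((Iio 0).indicator fun x => ENNReal.ofReal (Real.exp (a * x))) s volume ≠ ∞ := by
  rw [eLpNorm_indicator_eq_eLpNorm_restrict measurableSet_Iio]
  obtain rfl | hs' := eq_or_ne s ∞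
  · refine ne_top_of_le_ne_top ENNReal.one_ne_top (essSup_le_of_ae_le _ ?_)
    filter_upwards [ae_restrict_mem measurableSet_Iio] with x (hx : x < 0)
    simpa using mul_nonpos_of_nonneg_of_nonpos ha hx.le
  refine ((eLpNorm_lt_top_iff_lintegral_rpow_enorm_lt_top hs hs').2 ?_).ne
  simp only [enorm_eq_self, ofReal_exp_rpow]
  have integrable : IntegrableOn (fun x => Real.exp (a * s.toReal * x)) (Iio 0) :=
    (integrableOn_exp_mul_Iic (mul_pos (has hs') (ENNReal.toReal_pos hs hs')) 0).mono_set
      Iio_subset_Iic_self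
  convert! integrable.lintegral_lt_top using 4
  ring_nf

theorem logLorentzNorm_indicator_Iio_one_le (a : ℝ) (s : ℝ≥0∞) (ξ : ℝ) :
    logLorentzNorm a s ((Iio (Real.exp ξ)).indicator 1) ≤ ENNReal.ofReal (Real.exp (a * ξ)) *
      eLpNorm ((Iio 0).indicator fun x => ENNReal.ofReal (Real.exp (a * x))) s volume := by
  set k : ℝ → ℝ≥0∞ := (Iio 0).indicator fun x => ENNReal.ofReal (Real.exp (a * x)) with hk
  have k_measurable : Measurable k := Measurable.indicator (by fun_prop) measurableSet_Iio
  rw [← eLpNorm_comp_measurePreserving k_measurable.aestronglyMeasurable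
    (measurePreserving_add_right volume (-ξ))]
  refine eLpNorm_le_mul_eLpNorm_of_ae_le_mul' (ae_of_all _ fun x => ?_) s
  rw [enorm_eq_self, enorm_eq_self, logRearrangement_indicator_Iio_one]
  by_cases hx : x < ξ
  · change _ ≤ ENNReal.ofReal (Real.exp (a * ξ)) * k (x + -ξ)
    rw [hk, indicator_of_mem (by simpa), indicator_of_mem (by simpa), ofReal_exp_mul]
    ring_nf
    exact le_rfl
  · simp [hx]

theorem nonpos_of_forall_ofReal_exp_mul_le {K : ℝ≥0∞} (hK : K ≠ ∞)
    (h : ∀ ξ, 0 ≤ ξ → ENNReal.ofReal (Real.exp (d * ξ)) ≤ K) : d ≤ 0 := by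
  by_contra! hd
  have := h (K.toReal / d) (by positivity)
  rw [mul_div_cancel₀ _ hd.ne', ENNReal.ofReal_le_iff_le_toReal hK] at this
  linarith [Real.add_one_le_exp K.toReal]

/-- The function equal to `min 1 (t ^ (-a))` for `t < exp M` and vanishing afterwards. As `M → ∞`
its norm grows like `M ^ (1 / s)`, which detects the second exponent of a Lorentz space. -/
def truncatedPower (a M : ℝ) : ℝ → ℝ≥0∞ :=
  (Iio (Real.exp M)).indicator fun t => ENNReal.ofReal (min 1 (t ^ (-a)))

theorem measurable_truncatedPower (a M : ℝ) : Measurable (truncatedPower a M) :=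
  Measurable.indicator (by fun_prop) measurableSet_Iio

theorem logRearrangement_truncatedPower (ha : 0 ≤ a) (M x : ℝ) :
    logRearrangement a (truncatedPower a M) x =
      (Iio M).indicator (fun x => ENNReal.ofReal (min (Real.exp (a * x)) 1)) x := by
  have antitone_power : AntitoneOn (fun t : ℝ => ENNReal.ofReal (min 1 (t ^ (-a)))) (Ioi 0) :=
    fun x hx y _ hxy => ENNReal.ofReal_le_ofReal <| min_le_min_left _ <|
      Real.rpow_le_rpow_of_nonpos hx hxy (neg_nonpos.2 ha)
  have continuous_power : ContinuousOn (fun t : ℝ => ENNReal.ofReal (min 1 (t ^ (-a)))) (Ioi 0) :=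
    ENNReal.continuous_ofReal.comp_continuousOn <| continuousOn_const.inf <|
      continuousOn_id.rpow_const fun x hx => Or.inl (ne_of_gt hx)
  rw [truncatedPower, logRearrangement_indicator_Iio antitone_power continuous_power]
  congr! 2 with x
  rw [← ENNReal.ofReal_mul (Real.exp_nonneg _), mul_min_of_nonneg _ _ (Real.exp_nonneg _),
    ← Real.exp_mul, ← Real.exp_add]
  ring_nf
  simp

theorem rpow_le_logLorentzNorm_truncatedPower (ha : 0 ≤ a) (hs : s ≠ 0) {M : ℝ} (hM : 0 < M) :
    ENNReal.ofReal M ^ (1 / s.toReal) ≤ logLorentzNorm a s (truncatedPower a M) := by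
  have measure_Ico : volume (Ico 0 M) = ENNReal.ofReal M := by simp
  rw [← one_mul (ENNReal.ofReal M ^ _), ← measure_Ico]
  refine mul_measure_rpow_le_eLpNorm hs measurableSet_Ico (by simpa) fun x hx => ?_
  rw [logRearrangement_truncatedPower ha, indicator_of_mem (mem_Iio.2 hx.2)]
  simpa using mul_nonneg ha hx.1

theorem logLorentzNorm_truncatedPower_le (ha : 0 ≤ a) (hs : 1 ≤ s) {M : ℝ} (hM : 0 < M) :
    logLorentzNorm a s (truncatedPower a M) ≤
      eLpNorm ((Iio 0).indicator fun x => ENNReal.ofReal (Real.exp (a * x))) s volume +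
        ENNReal.ofReal M ^ (1 / s.toReal) := by
  set k : ℝ → ℝ≥0∞ := (Iio 0).indicator fun x => ENNReal.ofReal (Real.exp (a * x)) with hk
  have k_measurable : Measurable k := Measurable.indicator (by fun_prop) measurableSet_Iio
  let u : ℝ → ℝ≥0∞ := (Ico 0 M).indicator fun _ => 1
  have u_measurable : Measurable u := measurable_const.indicator measurableSet_Ico
  have eLpNorm_u : eLpNorm u s volume = ENNReal.ofReal M ^ (1 / s.toReal) := by
    rw [eLpNorm_indicator_const' measurableSet_Ico (by simpa) (one_pos.trans_le hs).ne']
    simp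
  have le_add : ∀ x, logRearrangement a (truncatedPower a M) x ≤ (k + u) x := by
    intro x
    rw [logRearrangement_truncatedPower ha]
    by_cases hxM : x < M <;> by_cases hx : x < 0
    · simp [hxM, hx, hk, u]
    · simp [hxM, hx, hk, u, not_lt.1 hx]
    · simp [hxM]
    · simp [hxM]
  rw [← eLpNorm_u]
  exact (eLpNorm_mono_enorm le_add).trans
    (eLpNorm_add_le k_measurable.aestronglyMeasurable u_measurable.aestronglyMeasurable hs)

theorem ofReal_exp_le_mul_iff {u v : ℝ} {K : ℝ≥0∞} :
    ENNReal.ofReal (Real.exp u) ≤ K * ENNReal.ofReal (Real.exp v) ↔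
      ENNReal.ofReal (Real.exp (u - v)) ≤ K := by
  rw [Real.exp_sub, ENNReal.ofReal_div_of_pos (Real.exp_pos v),
    ENNReal.div_le_iff (ENNReal.ofReal_pos.2 (Real.exp_pos v)).ne' ENNReal.ofReal_ne_top]

theorem exponent_le_of_isBoundedOp_id (ha : 0 ≤ a) (hs₁ : 1 ≤ s₁) (has : s₁ ≠ ∞ → 0 < a)
    (hs₂ : s₂ ≠ 0) (h : IsBoundedOp id (logLorentzNorm a s₁) (logLorentzNorm a s₂)) :
    s₁ ≤ s₂ := by
  obtain ⟨C, hC⟩ := h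
  have hs₁' := (one_pos.trans_le hs₁).ne'
  have hK := eLpNorm_indicator_Iio_exp_ne_top ha hs₁' has
  set K := eLpNorm ((Iio 0).indicator fun x => ENNReal.ofReal (Real.exp (a * x))) s₁ volume
  have growth_le : ∀ ξ : ℝ, 0 ≤ ξ →
      ENNReal.ofReal (Real.exp ((s₂⁻¹.toReal - s₁⁻¹.toReal) * ξ)) ≤ C * (K + 1) := by
    intro ξ hξ
    have upper := logLorentzNorm_truncatedPower_le ha hs₁ (Real.exp_pos ξ)
    have lower := rpow_le_logLorentzNorm_truncatedPower ha hs₂ (Real.exp_pos ξ)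
    have bounded := hC _ (measurable_truncatedPower a (Real.exp ξ)).aemeasurable
      (upper.trans_lt (by finiteness))
    rw [ofReal_exp_rpow, one_div, ← ENNReal.toReal_inv] at upper lower
    have one_le : 1 ≤ ENNReal.ofReal (Real.exp (ξ * s₁⁻¹.toReal)) := by
      simpa using mul_nonneg hξ (inv_nonneg.2 ENNReal.toReal_nonneg)
    rw [sub_mul, ← ofReal_exp_le_mul_iff, mul_comm _ ξ, mul_comm _ ξ, mul_assoc, add_mul, one_mul]
    refine (lower.trans bounded).trans (mul_le_mul_right (upper.trans ?_) _)
    gcongr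
    exact le_mul_of_one_le_right' one_le
  have inv_le := sub_nonpos.1 (nonpos_of_forall_ofReal_exp_mul_le (by finiteness) growth_le)
  rwa [ENNReal.toReal_le_toReal (by simpa) (by simpa), ENNReal.inv_le_inv] at inv_le

theorem IsBoundedOp.id_of_le {T : (ℝ → ℝ≥0∞) → ℝ → ℝ≥0∞} {ρ₁ ρ₂ ρ : (ℝ → ℝ≥0∞) → ℝ≥0∞}
    (h : IsBoundedOp T ρ₁ ρ₂) (hρ : ∃ D : ℝ≥0, ∀ f, ρ f ≤ D * ρ₂ (T f)) :
    IsBoundedOp id ρ₁ ρ := by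
  obtain ⟨C, hC⟩ := h
  obtain ⟨D, hD⟩ := hρ
  refine ⟨D * C, fun f hf hf' => (hD f).trans ?_⟩
  push_cast
  rw [mul_assoc]
  exact mul_le_mul_right (hC f hf hf') _

theorem eLpNorm_le_of_forall_restrict_Iic {g : ℝ → ℝ≥0∞} {K : ℝ≥0∞} (hs : s ≠ 0) (hs' : s ≠ ∞)
    (h : ∀ y, eLpNorm g s (volume.restrict (Iic y)) ≤ K) : eLpNorm g s volume ≤ K := by
  have hpos := ENNReal.toReal_pos hs hs'
  simp only [eLpNorm_eq_lintegral_rpow_enorm_toReal hs hs', one_div,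
    ENNReal.rpow_inv_le_iff hpos] at h ⊢
  have iUnion_Iic_natCast : ⋃ n : ℕ, Iic (n : ℝ) = univ :=
    iUnion_eq_univ_iff.2 fun x => exists_nat_ge x
  rw [← setLIntegral_univ, ← iUnion_Iic_natCast, setLIntegral_iUnion_of_directed _
    (directed_of_isDirected_le fun m n hmn => Iic_subset_Iic.2 (Nat.cast_le.2 hmn))]
  exact iSup_le fun n => h n

theorem exists_logLorentzNorm_le_hardyOp_endpoint (hα : 0 ≤ α) (hκ : 0 < κ) (hp : 0 < p)
    (hq₀ : q₀ ≠ 0) :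
    ∃ C : ℝ≥0, ∀ f, logLorentzNorm (1 / p) q₀ f ≤
      C * logLorentzNorm α ∞ (hardyOp α κ p q₀ f) := by
  obtain rfl | hq₀' := eq_or_ne q₀ ∞
  · exact exists_logLorentzNorm_le_hardyOp hα hκ hp hq₀ (by ring) ∞
  refine ⟨(Real.exp α).toNNReal, fun f => eLpNorm_le_of_forall_restrict_Iic hq₀ hq₀' fun y => ?_⟩
  refine le_trans ?_ ((quasiIncreasing_hardyOp hp hq₀ hκ.le α f).eLpNorm_le_eLpNorm_logRearrangement
    hα α ∞)
  have : ∀ x ∈ Ici (y / κ), eLpNorm (logRearrangement (1 / p) f) q₀ (volume.restrict (Iic y)) ≤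
      ENNReal.ofReal (Real.exp (α * x)) * hardyOp α κ p q₀ f (Real.exp x) := by
    intro x (hx : y / κ ≤ x)
    rw [ofReal_exp_mul_hardyOp hp hq₀, sub_self, zero_mul, Real.exp_zero, ENNReal.ofReal_one,
      one_mul]
    exact monotone_eLpNorm_logRearrangement_Iic _ _ _ ((div_le_iff₀' hκ).1 hx)
  simpa using mul_measure_rpow_le_eLpNorm ENNReal.top_ne_zero measurableSet_Ici (by simp) this

theorem IsBoundedOp.exists_eLpNorm_hardyOp_indicator_le (hα : 0 ≤ α) (hκ : 0 ≤ κ) (hp : 0 < p)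
    (hq₀ : q₀ ≠ 0) (ha : 0 ≤ a) (hs₁ : s₁ ≠ 0) (has : s₁ ≠ ∞ → 0 < a)
    (h : IsBoundedOp (hardyOp α κ p q₀) (logLorentzNorm a s₁) (logLorentzNorm b s₂)) :
    ∃ K : ℝ≥0, ∀ ξ : ℝ, eLpNorm (fun x => ENNReal.ofReal (Real.exp (b * x)) *
      hardyOp α κ p q₀ ((Iio (Real.exp ξ)).indicator 1) (Real.exp x)) s₂ volume ≤
        K * ENNReal.ofReal (Real.exp (a * ξ)) := by
  obtain ⟨C, hC⟩ := h
  have hK := eLpNorm_indicator_Iio_exp_ne_top ha hs₁ has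
  set K := eLpNorm ((Iio 0).indicator fun x => ENNReal.ofReal (Real.exp (a * x))) s₁ volume
  refine ⟨(ENNReal.ofReal (Real.exp α) * C * K).toNNReal, fun ξ => ?_⟩
  rw [ENNReal.coe_toNNReal (by finiteness)]
  set f : ℝ → ℝ≥0∞ := (Iio (Real.exp ξ)).indicator 1
  have f_measurable : Measurable f := measurable_one.indicator measurableSet_Iio
  have norm_f_le : logLorentzNorm a s₁ f ≤ ENNReal.ofReal (Real.exp (a * ξ)) * K :=
    logLorentzNorm_indicator_Iio_one_le a s₁ ξ
  calc eLpNorm (fun x => ENNReal.ofReal (Real.exp (b * x)) *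
        hardyOp α κ p q₀ f (Real.exp x)) s₂ volume
      ≤ ENNReal.ofReal (Real.exp α) * logLorentzNorm b s₂ (hardyOp α κ p q₀ f) :=
        (quasiIncreasing_hardyOp hp hq₀ hκ α f).eLpNorm_le_eLpNorm_logRearrangement hα b s₂
    _ ≤ ENNReal.ofReal (Real.exp α) * (C * (ENNReal.ofReal (Real.exp (a * ξ)) * K)) := by
        gcongr
        exact (hC f f_measurable.aemeasurable (norm_f_le.trans_lt (by finiteness))).trans
          (mul_le_mul_right norm_f_le _)
    _ = _ := by ring

theorem ofReal_exp_le_hardyOp_indicator (hp : 0 < p) (hq₀ : q₀ ≠ 0) {x y ξ : ℝ} (hyξ : y < ξ)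
    (hyx : y ≤ κ * x) :
    ENNReal.ofReal (Real.exp ((b - α) * x + 1 / p * (y - 1))) ≤
      ENNReal.ofReal (Real.exp (b * x)) *
        hardyOp α κ p q₀ ((Iio (Real.exp ξ)).indicator 1) (Real.exp x) := by
  have rearrangement_eq_one : rearrangement ((Iio (Real.exp ξ)).indicator 1) (Real.exp y) = 1 := by
    rw [rearrangement_indicator_Iio (g := 1) antitoneOn_const continuousOn_const _ (Real.exp_pos y)]
    simp [hyξ]
  have := mul_rearrangement_le_eLpNorm_logRearrangement (a := 1 / p) (by positivity) hq₀
    ((Iio (Real.exp ξ)).indicator 1) (isLowerSet_Iic (κ * x)) hyx (sub_one_lt y)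
  rw [rearrangement_eq_one, sub_sub_cancel, ENNReal.ofReal_one, ENNReal.one_rpow, mul_one,
    mul_one] at this
  rw [ofReal_exp_mul_hardyOp hp hq₀, ← ofReal_exp_mul]
  exact mul_le_mul_right this _

theorem IsBoundedOp.hardyOp_scaling (hα : 0 ≤ α) (hκ : 0 < κ) (hp : 0 < p)
    (hq₀ : q₀ ≠ 0) (ha : 0 ≤ a) (hs₁ : s₁ ≠ 0) (has : s₁ ≠ ∞ → 0 < a) (hs₂ : s₂ ≠ 0)
    (h : IsBoundedOp (hardyOp α κ p q₀) (logLorentzNorm a s₁) (logLorentzNorm b s₂)) :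
    κ * (1 / p - a) = α - b := by
  obtain ⟨K, hK⟩ := h.exists_eLpNorm_hardyOp_indicator_le hα hκ.le hp hq₀ ha hs₁ has
  set c := b - α + κ / p with hc
  have lower : ∀ ξ, ∀ x ∈ Ico (ξ / κ - 1) (ξ / κ),
      ENNReal.ofReal (Real.exp (c * (ξ / κ) - |c| - 1 / p)) ≤
        ENNReal.ofReal (Real.exp (b * x)) *
          hardyOp α κ p q₀ ((Iio (Real.exp ξ)).indicator 1) (Real.exp x) := by
    intro ξ x hx
    refine le_trans ?_ (ofReal_exp_le_hardyOp_indicator hp hq₀ ((lt_div_iff₀' hκ).1 hx.2) le_rfl)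
    gcongr
    have : c * (ξ / κ - x) ≤ |c| := by nlinarith [le_abs_self c, abs_nonneg c, hx.1, hx.2]
    calc c * (ξ / κ) - |c| - 1 / p ≤ c * x - 1 / p := by linarith
      _ = _ := by rw [hc]; ring
  have exp_le : ∀ ξ, ENNReal.ofReal (Real.exp ((c / κ - a) * ξ)) ≤
      K * ENNReal.ofReal (Real.exp (|c| + 1 / p)) := by
    intro ξ
    have := (mul_measure_rpow_le_eLpNorm (μ := volume) hs₂ measurableSet_Ico (by simp)
      (lower ξ)).trans (hK ξ)
    rw [Real.volume_Ico, sub_sub_cancel, ENNReal.ofReal_one, ENNReal.one_rpow, mul_one,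
      ofReal_exp_le_mul_iff] at this
    rw [ofReal_exp_le_mul_iff]
    convert this using 3
    ring
  have hle := nonpos_of_forall_ofReal_exp_mul_le
    (K := K * ENNReal.ofReal (Real.exp (|c| + 1 / p))) (by finiteness) fun ξ _ => exp_le ξ
  have hge := nonpos_of_forall_ofReal_exp_mul_le (d := -(c / κ - a))
    (K := K * ENNReal.ofReal (Real.exp (|c| + 1 / p))) (by finiteness) fun ξ _ =>
      neg_mul_comm (c / κ - a) ξ ▸ exp_le (-ξ)
  have : c / κ = a := by linarith
  rw [div_eq_iff hκ.ne'] at this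
  linear_combination this

theorem IsBoundedOp.hardyOp_decay (hα : 0 ≤ α) (hκ : 0 ≤ κ) (hp : 0 < p)
    (hq₀ : q₀ ≠ 0) (ha : 0 ≤ a) (hs₁ : s₁ ≠ 0) (has : s₁ ≠ ∞ → 0 < a) (hs₂ : s₂ ≠ 0)
    (h : IsBoundedOp (hardyOp α κ p q₀) (logLorentzNorm a s₁) (logLorentzNorm b s₂)) :
    b < α ∨ b = α ∧ s₂ = ∞ := by
  obtain ⟨K, hK⟩ := h.exists_eLpNorm_hardyOp_indicator_le hα hκ hp hq₀ ha hs₁ has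
  obtain hlt | hle := lt_or_ge b α
  · exact Or.inl hlt
  have lower : ∀ ξ, 0 ≤ ξ → ∀ x ∈ Ici ξ,
      ENNReal.ofReal (Real.exp ((b - α) * ξ - 2 / p)) ≤
        ENNReal.ofReal (Real.exp (b * x)) *
          hardyOp α κ p q₀ ((Iio (Real.exp 0)).indicator 1) (Real.exp x) := by
    intro ξ hξ x (hx : ξ ≤ x)
    refine le_trans ?_ (ofReal_exp_le_hardyOp_indicator hp hq₀ neg_one_lt_zero
      (neg_one_lt_zero.le.trans (mul_nonneg hκ (hξ.trans hx))))
    gcongr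
    calc (b - α) * ξ - 2 / p ≤ (b - α) * x - 2 / p := by gcongr
      _ = _ := by ring
  have upper : ∀ ξ, 0 ≤ ξ → ENNReal.ofReal (Real.exp ((b - α) * ξ - 2 / p)) *
      ∞ ^ (1 / s₂.toReal) ≤ K := fun ξ hξ => by
    simpa using (mul_measure_rpow_le_eLpNorm (μ := volume) hs₂ measurableSet_Ici (by simp)
      (lower ξ hξ)).trans (hK 0)
  have hs₂_top : s₂ = ∞ := by
    by_contra hs₂_top
    have hpos := ENNReal.toReal_pos hs₂ hs₂_top
    have := upper 0 le_rfl
    rw [ENNReal.top_rpow_of_pos (by positivity), ENNReal.mul_top (by simp [Real.exp_pos])] at this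
    simp at this
  refine Or.inr ⟨hle.antisymm' (sub_nonpos.1 (nonpos_of_forall_ofReal_exp_mul_le
    (K := K * ENNReal.ofReal (Real.exp (2 / p))) (by finiteness) fun ξ hξ => ?_)), hs₂_top⟩
  simpa [ofReal_exp_le_mul_iff, hs₂_top] using upper ξ hξ

theorem isBoundedOp_hardyOp_iff (hα : 0 ≤ α) (hκ : 0 < κ) (hp : 0 < p) (hq₀ : 1 ≤ q₀)
    (ha : 0 ≤ a) (hs₁ : 1 ≤ s₁) (has : s₁ ≠ ∞ → 0 < a) (hb : 0 ≤ b) (hs₂ : s₂ ≠ 0)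
    (hbs : s₂ ≠ ∞ → 0 < b) :
    IsBoundedOp (hardyOp α κ p q₀) (logLorentzNorm a s₁) (logLorentzNorm b s₂) ↔
      κ * (1 / p - a) = α - b ∧
        (a = 1 / p ∧ s₁ ≤ q₀ ∧ s₂ = ∞ ∨ a < 1 / p ∧ s₁ ≤ s₂) := by
  have hs₁' := (one_pos.trans_le hs₁).ne'
  have hq₀' := (one_pos.trans_le hq₀).ne'
  constructor
  · intro h
    have scaling := h.hardyOp_scaling hα hκ hp hq₀' ha hs₁' has hs₂
    refine ⟨scaling, ?_⟩
    obtain hbα | ⟨rfl, rfl⟩ := h.hardyOp_decay hα hκ.le hp hq₀' ha hs₁' has hs₂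
    · have hap : 0 < 1 / p - a := pos_of_mul_pos_right (scaling ▸ sub_pos.2 hbα) hκ.le
      exact Or.inr ⟨sub_pos.1 hap, exponent_le_of_isBoundedOp_id ha hs₁ has hs₂
        (h.id_of_le (exists_logLorentzNorm_le_hardyOp hα hκ hp hq₀' scaling s₂))⟩
    · obtain rfl : 1 / p = a := by simpa [hκ.ne', sub_eq_zero] using scaling
      exact Or.inl ⟨rfl, exponent_le_of_isBoundedOp_id ha hs₁ has hq₀'
        (h.id_of_le (exists_logLorentzNorm_le_hardyOp_endpoint hα hκ hp hq₀')), rfl⟩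
  · rintro ⟨hab, ⟨rfl, hs, rfl⟩ | ⟨hap, hs⟩⟩
    · obtain rfl : α = b := by linarith
      obtain ⟨C, hC⟩ := exists_logLorentzNorm_hardyOp_endpoint_le hα hκ.le hp hs₁' hs
      exact ⟨C, fun f _ _ => hC f⟩
    · obtain ⟨C, hC⟩ := exists_logLorentzNorm_hardyOp_le hα hκ hp hq₀ hs₁ hs ha hap hab hb hbs
      exact ⟨C, fun f _ _ => hC f⟩

end Necessity

section Parameters

variable {p p₀ p₁ q : ℝ} {q₀ r r₁ r₂ s s₁ s₂ : ℝ≥0∞}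

/-- The pairs `(r, s)` with `0 < r ≤ ∞` and `1 ≤ s ≤ ∞` for which `‖·‖_{r,s}` is finite on the
indicators of sets of finite measure. They include all normable pairs, and also the pairs with
`r < 1` or `r = 1 < s`, for which `L^{r,s}` is only quasi-normed. -/
structure AdmissibleParams (r s : ℝ≥0∞) : Prop where
  ne_zero : r ≠ 0
  one_le : 1 ≤ s
  eq_top : r = ∞ → s = ∞

theorem NormableParams.admissibleParams (h : NormableParams r s) : AdmissibleParams r s := by
  obtain ⟨rfl, rfl⟩ | ⟨hr, hr', hs⟩ | ⟨rfl, rfl⟩ := h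
  · exact ⟨one_ne_zero, le_rfl, by simp⟩
  · exact ⟨(one_pos.trans hr).ne', hs, fun h => absurd h hr'.ne⟩
  · exact ⟨ENNReal.top_ne_zero, le_top, fun _ => rfl⟩

theorem AdmissibleParams.toReal_inv_pos (h : AdmissibleParams r s) (hs : s ≠ ∞) :
    0 < r⁻¹.toReal :=
  ENNReal.toReal_pos (ENNReal.inv_ne_zero.2 fun hr => hs (h.eq_top hr))
    (ENNReal.inv_ne_top.2 h.ne_zero)

theorem AdmissibleParams.lorentzNorm_eq (h : AdmissibleParams r s) :
    lorentzNorm r s = logLorentzNorm r⁻¹.toReal s :=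
  funext (lorentzNorm_eq_eLpNorm (one_pos.trans_le h.one_le).ne')

theorem toReal_inv_lt_one_div_iff (hp : 0 < p) (hr : r ≠ 0) :
    r⁻¹.toReal < 1 / p ↔ ENNReal.ofReal p < r := by
  rw [one_div, ← ENNReal.toReal_ofReal hp.le, ← ENNReal.toReal_inv,
    ENNReal.toReal_lt_toReal (by simpa) (by simpa using hp), ENNReal.inv_lt_inv,
    ENNReal.toReal_ofReal hp.le]

theorem toReal_inv_eq_one_div_iff (hp : 0 < p) (hr : r ≠ 0) :
    r⁻¹.toReal = 1 / p ↔ r = ENNReal.ofReal p := by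
  rw [one_div, ← ENNReal.toReal_ofReal hp.le, ← ENNReal.toReal_inv,
    ENNReal.toReal_eq_toReal_iff' (by simpa) (by simpa using hp), inv_inj,
    ENNReal.toReal_ofReal hp.le]

theorem rExp_pos (hp₀ : 0 < p₀) (hq : p₀ < q) (hp₁ : 0 < p₁) : 0 < rExp p₀ p₁ q :=
  div_pos (mul_pos hp₀ (hp₀.trans hq)) (mul_pos hp₁ (sub_pos.2 hq))

theorem rExp_mul_sub (hp₀ : p₀ ≠ 0) (hpq : q - p₀ ≠ 0) (hq : q ≠ 0) (p₁ : ℝ) :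
    rExp p₀ p₁ q * (1 / p₀ - 1 / q) = 1 / p₁ := by
  rw [rExp]
  field_simp

theorem inv_add_inv_rExp_mul_eq_iff (hp₀ : 0 < p₀) (hq : p₀ < q) (hp₁ : 0 < p₁) (hr₁ : r₁ ≠ 0)
    (hr₂ : r₂ ≠ 0) :
    (ENNReal.ofReal q)⁻¹ + (ENNReal.ofReal (rExp p₀ p₁ q) * r₂)⁻¹ = r₁⁻¹ ↔
      rExp p₀ p₁ q * (1 / p₀ - r₁⁻¹.toReal) = 1 / p₁ - r₂⁻¹.toReal := by
  have hq_pos : 0 < q := hp₀.trans hq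
  have hκ := rExp_pos hp₀ hq hp₁
  have hq' : ENNReal.ofReal q ≠ 0 := (ENNReal.ofReal_pos.2 hq_pos).ne'
  rw [← ENNReal.toReal_eq_toReal_iff' (by finiteness) (by finiteness),
    ENNReal.toReal_add (by finiteness) (by finiteness)]
  simp only [ENNReal.toReal_inv, ENNReal.toReal_mul, ENNReal.toReal_ofReal hq_pos.le,
    ENNReal.toReal_ofReal hκ.le, mul_inv]
  rw [← mul_right_inj' hκ.ne', mul_add, mul_inv_cancel_left₀ hκ.ne']
  have := rExp_mul_sub hp₀.ne' (sub_pos.2 hq).ne' hq_pos.ne' p₁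
  constructor <;> intro scaling
  · linear_combination this + scaling
  · linear_combination scaling - this

theorem isBoundedOp_opR_iff (hp₀ : 0 < p₀) (hq : p₀ < q) (hp₁ : 0 < p₁) (hq₀ : 1 ≤ q₀)
    (h₁ : AdmissibleParams r₁ s₁) (h₂ : AdmissibleParams r₂ s₂) :
    IsBoundedOp (opR p₀ p₁ q q₀) (lorentzNorm r₁ s₁) (lorentzNorm r₂ s₂) ↔
      (ENNReal.ofReal q)⁻¹ + (ENNReal.ofReal (rExp p₀ p₁ q) * r₂)⁻¹ = r₁⁻¹ ∧
      ((r₁ = ENNReal.ofReal p₀ ∧ s₁ ≤ q₀ ∧ s₂ = ∞) ∨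
        (ENNReal.ofReal p₀ < r₁ ∧ r₁ ≤ ENNReal.ofReal q ∧ 1 ≤ s₁ ∧ s₁ ≤ s₂)) := by
  have opR_eq_hardyOp : opR p₀ p₁ q q₀ = hardyOp (1 / p₁) (rExp p₀ p₁ q) p₀ q₀ := rfl
  rw [opR_eq_hardyOp, h₁.lorentzNorm_eq, h₂.lorentzNorm_eq,
    isBoundedOp_hardyOp_iff (by positivity) (rExp_pos hp₀ hq hp₁) hp₀ hq₀ ENNReal.toReal_nonneg
      h₁.one_le h₁.toReal_inv_pos ENNReal.toReal_nonneg (one_pos.trans_le h₂.one_le).ne'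
      h₂.toReal_inv_pos,
    ← inv_add_inv_rExp_mul_eq_iff hp₀ hq hp₁ h₁.ne_zero h₂.ne_zero,
    toReal_inv_eq_one_div_iff hp₀ h₁.ne_zero, toReal_inv_lt_one_div_iff hp₀ h₁.ne_zero]
  refine and_congr_right fun scaling => or_congr_right <| and_congr_right fun _ => ?_
  have r₁_le : r₁ ≤ ENNReal.ofReal q := ENNReal.inv_le_inv.1 (le_self_add.trans_eq scaling)
  simp only [r₁_le, h₁.one_le, true_and]

theorem angleNorm_eq_hardyOp (ρ : (ℝ → ℝ≥0∞) → ℝ≥0∞) (p : ℝ) (q₀ : ℝ≥0∞) (f : ℝ → ℝ≥0∞) :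
    angleNorm ρ p q₀ f = ρ (hardyOp (1 / p) 1 p q₀ f) := by
  unfold angleNorm hardyOp
  simp only [Real.rpow_one]

theorem normEquiv_angleNorm (hp : 0 < p) (hq₀ : 1 ≤ q₀) (hpr : ENNReal.ofReal p < r)
    (h : AdmissibleParams r s) :
    NormEquiv (angleNorm (lorentzNorm r s) p q₀) (lorentzNorm r s) := by
  have inv_lt : r⁻¹.toReal < 1 / p := (toReal_inv_lt_one_div_iff hp h.ne_zero).2 hpr
  have scaling : 1 * (1 / p - r⁻¹.toReal) = 1 / p - r⁻¹.toReal := one_mul _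
  obtain ⟨C, hC⟩ := exists_logLorentzNorm_hardyOp_le (by positivity) one_pos hp hq₀ h.one_le le_rfl
    ENNReal.toReal_nonneg inv_lt scaling ENNReal.toReal_nonneg h.toReal_inv_pos
  obtain ⟨D, hD⟩ := exists_logLorentzNorm_le_hardyOp (by positivity) one_pos hp
    (one_pos.trans_le hq₀).ne' scaling s
  refine ⟨max (max C D) 1, by positivity, fun f _ => ?_⟩
  rw [angleNorm_eq_hardyOp, h.lorentzNorm_eq]
  exact ⟨(hC f).trans (by gcongr; simp), (hD f).trans (by gcongr; simp)⟩

theorem measurable_ereal_abs : Measurable EReal.abs :=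
  EReal.measurable_of_measurable_real (by simp only [EReal.abs_def]; fun_prop)

theorem NormEquiv.space_eq {ρ₁ ρ₂ : (ℝ → ℝ≥0∞) → ℝ≥0∞} (h : NormEquiv ρ₁ ρ₂) :
    space ρ₁ = space ρ₂ := by
  obtain ⟨C, -, hC⟩ := h
  ext f
  refine and_congr_right fun hf => ?_
  obtain ⟨h₁₂, h₂₁⟩ := hC (fun t => (f t).abs) (measurable_ereal_abs.comp_aemeasurable hf)
  exact ⟨fun h => h₂₁.trans_lt (by finiteness), fun h => h₁₂.trans_lt (by finiteness)⟩

end Parameters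

end LorentzCalderon

end

theorem mainTheorem6_general (p₀ p₁ q : ℝ) (q₀ : ℝ≥0∞) (hp₀ : 0 < p₀) (hq : p₀ < q)
    (hp₁ : 0 < p₁) (hq₀ : 1 ≤ q₀) :
    (∀ r₁ r₂ s₁ s₂ : ℝ≥0∞, AdmissibleParams r₁ s₁ → AdmissibleParams r₂ s₂ →
      (IsBoundedOp (opR p₀ p₁ q q₀) (lorentzNorm r₁ s₁) (lorentzNorm r₂ s₂) ↔
        (ENNReal.ofReal q)⁻¹ + (ENNReal.ofReal (rExp p₀ p₁ q) * r₂)⁻¹ = r₁⁻¹ ∧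
        ((r₁ = ENNReal.ofReal p₀ ∧ s₁ ≤ q₀ ∧ s₂ = ∞) ∨
          (ENNReal.ofReal p₀ < r₁ ∧ r₁ ≤ ENNReal.ofReal q ∧ 1 ≤ s₁ ∧ s₁ ≤ s₂)))) ∧
    (∀ (p : ℝ) (r s : ℝ≥0∞), 0 < p → ENNReal.ofReal p < r → AdmissibleParams r s →
      space (angleNorm (lorentzNorm r s) p q₀) = space (lorentzNorm r s) ∧
      NormEquiv (angleNorm (lorentzNorm r s) p q₀) (lorentzNorm r s)) := by
  refine ⟨fun _ _ _ _ => isBoundedOp_opR_iff hp₀ hq hp₁ hq₀, fun p r s hp hpr h => ?_⟩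
  have equivalence := normEquiv_angleNorm hp hq₀ hpr h
  exact ⟨equivalence.space_eq, equivalence⟩

theorem mainTheorem6 (p₀ p₁ q : ℝ) (q₀ : ℝ≥0∞) (hp₀ : 1 < p₀) (hq : p₀ < q) (hp₁ : 1 < p₁)
    (hq₀ : 1 ≤ q₀) :
    (∀ r₁ r₂ s₁ s₂ : ℝ≥0∞, NormableParams r₁ s₁ → NormableParams r₂ s₂ →
      (IsBoundedOp (opR p₀ p₁ q q₀) (lorentzNorm r₁ s₁) (lorentzNorm r₂ s₂) ↔
        (ENNReal.ofReal q)⁻¹ + (ENNReal.ofReal (rExp p₀ p₁ q) * r₂)⁻¹ = r₁⁻¹ ∧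
        ((r₁ = ENNReal.ofReal p₀ ∧ s₁ ≤ q₀ ∧ s₂ = ∞) ∨
          (ENNReal.ofReal p₀ < r₁ ∧ r₁ ≤ ENNReal.ofReal q ∧ 1 ≤ s₁ ∧ s₁ ≤ s₂)))) ∧
    (∀ (p : ℝ) (r s : ℝ≥0∞), 1 ≤ p → ENNReal.ofReal p < r → NormableParams r s →
      space (angleNorm (lorentzNorm r s) p q₀) = space (lorentzNorm r s) ∧
      NormEquiv (angleNorm (lorentzNorm r s) p q₀) (lorentzNorm r s)) := by
  have general := mainTheorem6_general p₀ p₁ q q₀ (by linarith) hq (by linarith) hq₀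
  exact ⟨fun _ _ _ _ h₁ h₂ => general.1 _ _ _ _ h₁.admissibleParams h₂.admissibleParams,
    fun p r s hp hpr h => general.2 p r s (by linarith) hpr h.admissibleParams⟩
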